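/- Let $(V_n)_{n\in\mathbb N}$ be a sequence of non-empty finite sets with $|V_n|\to\infty$ and let $\mathcal U$ be a non-principal ultrafilter on $\mathbb N$. Let $\Omega=\prod_n V_n/\mathcal U$ be the ultraproduct. For a finite index set $\iota$ and sets $A_n\subseteq V_n^\iota$, let $\lim\langle A_n\rangle\subseteq\Omega^\iota$ be the internal set of those tuples represented by a sequence $(y_n)$ with $y_n\in A_n$ for $\mathcal U$-almost every $n$; let $\mathcal B_\iota$ be the $\sigma$-algebra on $\Omega^\iota$ generated by the internal sets, and $\mu^\iota$ the Loeb measure, that is, the probability measure on $\mathcal B_\iota$ with $\mu^\iota(\lim\langle A_n\rangle)=\lim_{n\to\mathcal U}|A_n|/|V_n|^{|\iota|}$. Write $[k]=\{0,\dots,k-1\}$, $\mathcal B_k=\mathcal B_{[k]}$ and $\mu^k=\mu^{[k]}$. A collection $\mathcal I$ of subsets of $[k]$ is *subset-free* if it is non-empty and no member of $\mathcal I$ is a proper subset of another. For subset-free $\mathcal I,\mathcal J$ on $[k]$, write $\mathcal I\le\mathcal J$ if there is a bijection $\pi:[k]\to[k]$ such that every $I\in\mathcal I$ is contained in $\pi(J)$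 for some $J\in\mathcal J$. Let $\mathcal B_{k,\mathcal I}\subseteq\mathcal B_k$ be the $\sigma$-algebra generated by the sets $\{\vec x\in\Omega^k \mid \vec x|_I\in B_I \text{ for all } I\in\mathcal I\}$ with $B_I\in\mathcal B_I$. A set $E\in\mathcal B_k$ is $\mathtt{Disc}_p[\mathcal I]$ if $\mathbb E(\chi_E\mid\mathcal B_{k,\mathcal I})=p$ almost everywhere. **Theorem (Separating Randomness Notions, analytic version).** For every $k$, every subset-free $\mathcal I$ on $[k]$ with $\mathcal I\neq\{\emptyset\}$, and every $p\in(0,1)$, there is a set $E\in\mathcal B_k$, invariant under all permutations of the coordinates, with $\mu^k(E)=p$, such that $E$ is not $\mathtt{Disc}_p[\mathcal I]$, but $E$ is $\mathtt{Disc}_p[\mathcal J]$ for every subset-free $\mathcal J$ on $[k]$ with $\mathcal I\not\le\mathcal J$. -/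

import Mathlib

open MeasureTheory Filter
open scoped ENNReal

noncomputable section

namespace Quasirandom

universe u

section Ultraproduct

variable (V : ℕ → Type u) (𝒰 : Ultrafilter ℕ)

/-- The ultraproduct `Ω` of the sequence of sets `V n` along the ultrafilter `𝒰`. -/
def UProd : Type u := (𝒰 : Filter ℕ).Product V

variable {V 𝒰}
variable {ι : Type*}

/-- The tuple of elements of the ultraproduct represented by a sequence of tuples. -/
def mkTuple (𝒰 : Ultrafilter ℕ) (y : ∀ n, ι → V n) : ι → UProd V 𝒰 :=
  fun i => Quotient.mk ((𝒰 : Filter ℕ).productSetoid V) (fun n => y n i)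

/-- The internal set `lim ⟨A n⟩ ⊆ Ω ^ ι` determined by a sequence of sets `A n ⊆ (V n) ^ ι`. -/
def limSet (𝒰 : Ultrafilter ℕ) (A : ∀ n, Set (ι → V n)) : Set (ι → UProd V 𝒰) :=
  {x | ∃ y : ∀ n, ι → V n, mkTuple 𝒰 y = x ∧ ∀ᶠ n in (𝒰 : Filter ℕ), y n ∈ A n}

/-- The σ-algebra on `Ω ^ ι` generated by the internal sets.  For `ι = Fin k` this is `ℬ_k`, and
for a finite set `I` of indices, `ι = I` gives `ℬ_I`. -/
instance instMeasurableSpaceTuple : MeasurableSpace (ι → UProd V 𝒰) :=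
  MeasurableSpace.generateFrom {S | ∃ A : ∀ n, Set (ι → V n), S = limSet 𝒰 A}

/-- The limit along `𝒰` of the densities `|A n| / |V n| ^ |ι|`. -/
def ulimDensity (𝒰 : Ultrafilter ℕ) (A : ∀ n, Set (ι → V n)) : ℝ≥0∞ :=
  limUnder (𝒰 : Filter ℕ)
    (fun n => ((A n).ncard : ℝ≥0∞) / ((Nat.card (V n) : ℝ≥0∞) ^ Nat.card ι))

lemma tendsto_ulimDensity (A : ∀ n, Set (ι → V n)) :
    Tendsto (fun n => ((A n).ncard : ℝ≥0∞) / ((Nat.card (V n) : ℝ≥0∞) ^ Nat.card ι))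
      (𝒰 : Filter ℕ) (nhds (ulimDensity 𝒰 A)) := by
  apply tendsto_nhds_limUnder
  obtain ⟨x, -, hx⟩ := isCompact_univ.ultrafilter_le_nhds
    (𝒰.map (fun n => ((A n).ncard : ℝ≥0∞) / ((Nat.card (V n) : ℝ≥0∞) ^ Nat.card ι))) (by simp)
  exact ⟨x, hx⟩

lemma mkTuple_surjective (x : ι → UProd V 𝒰) : ∃ y : ∀ n, ι → V n, mkTuple 𝒰 y = x := by
  refine ⟨fun n i => Quotient.out (s := (𝒰 : Filter ℕ).productSetoid V) (x i) n, ?_⟩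
  funext i
  exact Quotient.out_eq (s := (𝒰 : Filter ℕ).productSetoid V) (x i)

lemma mkTuple_mem_limSet [Finite ι] (A : ∀ n, Set (ι → V n)) (y : ∀ n, ι → V n) :
    mkTuple 𝒰 y ∈ limSet 𝒰 A ↔ ∀ᶠ n in (𝒰 : Filter ℕ), y n ∈ A n := by
  constructor
  · rintro ⟨z, hz, hA⟩
    have h : ∀ᶠ n in (𝒰 : Filter ℕ), ∀ i, z n i = y n i := by
      rw [eventually_all]
      intro i
      exact Quotient.exact (s := (𝒰 : Filter ℕ).productSetoid V) (congrFun hz i)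
    filter_upwards [h, hA] with n hn hA
    rwa [← funext hn]
  · exact fun h => ⟨y, rfl, h⟩

lemma limSet_inter [Finite ι] (A B : ∀ n, Set (ι → V n)) :
    limSet 𝒰 A ∩ limSet 𝒰 B = limSet 𝒰 (fun n => A n ∩ B n) := by
  ext x
  obtain ⟨y, rfl⟩ := mkTuple_surjective x
  simp only [Set.mem_inter_iff, mkTuple_mem_limSet, eventually_and]

lemma limSet_diff [Finite ι] (A B : ∀ n, Set (ι → V n)) :
    limSet 𝒰 A \ limSet 𝒰 B = limSet 𝒰 (fun n => A n \ B n) := by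
  ext x
  obtain ⟨y, rfl⟩ := mkTuple_surjective x
  simp only [Set.mem_sdiff, mkTuple_mem_limSet, eventually_and, Ultrafilter.eventually_not]

/-- The density of internal sets, extended by `∞` to all other sets. -/
def internalDensity (S : Set (ι → UProd V 𝒰)) : ℝ≥0∞ :=
  ⨅ (A : ∀ n, Set (ι → V n)) (_ : limSet 𝒰 A = S), ulimDensity 𝒰 A

lemma internalDensity_limSet_le (A : ∀ n, Set (ι → V n)) {S : Set (ι → UProd V 𝒰)}
    (h : limSet 𝒰 A = S) : internalDensity S ≤ ulimDensity 𝒰 A :=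
  iInf₂_le (f := fun (A : ∀ n, Set (ι → V n)) (_ : limSet 𝒰 A = S) => ulimDensity 𝒰 A) A h

lemma internalDensity_empty : internalDensity (∅ : Set (ι → UProd V 𝒰)) = 0 := by
  have h0 : limSet 𝒰 (fun n => (∅ : Set (ι → V n))) = ∅ := by
    ext x
    simp [limSet, Ultrafilter.neBot 𝒰 |>.ne]
  have h1 : ulimDensity 𝒰 (fun n => (∅ : Set (ι → V n))) = 0 :=
    tendsto_nhds_unique (tendsto_ulimDensity (𝒰 := 𝒰) (fun n => (∅ : Set (ι → V n))))
      (by simp)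
  exact le_antisymm ((internalDensity_limSet_le _ h0).trans h1.le) bot_le

/-- The Loeb outer measure: countable coverings by internal sets. -/
def loebOuter (V : ℕ → Type u) (𝒰 : Ultrafilter ℕ) (ι : Type*) :
    OuterMeasure (ι → UProd V 𝒰) :=
  OuterMeasure.ofFunction internalDensity internalDensity_empty

lemma loebOuter_caratheodory [Finite ι] [∀ n, Finite (V n)] :
    (instMeasurableSpaceTuple : MeasurableSpace (ι → UProd V 𝒰)) ≤
      (loebOuter V 𝒰 ι).caratheodory := by
  refine MeasurableSpace.generateFrom_le ?_
  rintro S ⟨A, rfl⟩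
  refine OuterMeasure.ofFunction_caratheodory fun t => ?_
  refine le_iInf₂ fun T hT => ?_
  subst hT
  have h1 : internalDensity (limSet 𝒰 T ∩ limSet 𝒰 A) ≤
      ulimDensity 𝒰 (fun n => T n ∩ A n) := 
    internalDensity_limSet_le _ (limSet_inter T A).symm
  have h2 : internalDensity (limSet 𝒰 T \ limSet 𝒰 A) ≤
      ulimDensity 𝒰 (fun n => T n \ A n) := 
    internalDensity_limSet_le _ (limSet_diff T A).symm
  refine (add_le_add h1 h2).trans (le_of_eq ?_)
  refine tendsto_nhds_unique ((tendsto_ulimDensity (𝒰 := 𝒰) (fun n => T n ∩ A n)).add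
    (tendsto_ulimDensity (𝒰 := 𝒰) (fun n => T n \ A n))) ?_
  refine (tendsto_ulimDensity (𝒰 := 𝒰) T).congr fun n => ?_
  rw [← ENNReal.add_div, ← Nat.cast_add, Set.ncard_inter_add_ncard_sdiff_eq_ncard _ _ (Set.toFinite _)]

/-- The measure `μ ^ ι` of the ultraproduct (Loeb measure) on the σ-algebra generated by the
internal sets. -/
def loeb (V : ℕ → Type u) (𝒰 : Ultrafilter ℕ) (ι : Type*) [Finite ι] [∀ n, Finite (V n)] :
    Measure (ι → UProd V 𝒰) :=
  (loebOuter V 𝒰 ι).toMeasure loebOuter_caratheodory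

lemma measurableSet_limSet (A : ∀ n, Set (ι → V n)) : MeasurableSet (limSet 𝒰 A) :=
  MeasurableSpace.measurableSet_generateFrom ⟨A, rfl⟩

/-- Countable saturation: a countable covering of an internal set by internal sets has a finite
subcovering, which is already visible in the sets `V n`. -/
lemma limSet_cover [∀ n, Nonempty (V n)] [Finite ι] (h𝒰 : (𝒰 : Filter ℕ) ≤ cofinite)
    (A : ∀ n, Set (ι → V n)) (B : ℕ → ∀ n, Set (ι → V n))
    (h : limSet 𝒰 A ⊆ ⋃ j, limSet 𝒰 (B j)) :
    ∃ N : ℕ, ∀ᶠ n in (𝒰 : Filter ℕ), A n ⊆ ⋃ j ∈ Finset.range N, B j n := by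
  classical
  by_contra! hN
  let P : ℕ → ℕ → Prop := fun n N => ¬ A n ⊆ ⋃ j ∈ Finset.range N, B j n
  have hP : ∀ N, ∀ᶠ n in (𝒰 : Filter ℕ), P n N := hN
  have hy : ∀ n, ∃ y : ι → V n, ∀ N ≤ n, P n N →
      y ∈ A n ∧ ∀ j < N, y ∉ B j n := by
    intro n
    by_cases h0 : P n 0
    · have hg : P n (Nat.findGreatest (P n) n) :=
        Nat.findGreatest_spec (P := P n) (Nat.zero_le n) h0
      obtain ⟨y, hyA, hyB⟩ := Set.not_subset.1 hg
      refine ⟨y, fun N hNn hPN => ⟨hyA, fun j hj hB => hyB ?_⟩⟩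
      simp only [Set.mem_iUnion, Finset.mem_range]
      exact ⟨j, hj.trans_le (Nat.le_findGreatest hNn hPN), hB⟩
    · refine ⟨Classical.arbitrary _, fun N _ hPN => (hPN ?_).elim⟩
      have h0' : A n ⊆ ⋃ j ∈ Finset.range 0, B j n := not_not.1 h0
      simp only [Finset.range_zero, Finset.notMem_empty, Set.iUnion_of_empty, Set.iUnion_empty,
        Set.subset_empty_iff] at h0'
      simp [h0']
  choose y hy using hy
  have hge : ∀ N : ℕ, ∀ᶠ n in (𝒰 : Filter ℕ), N ≤ n := fun N => by
    have : ∀ᶠ n in (cofinite : Filter ℕ), N ≤ n := by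
      rw [Nat.cofinite_eq_atTop]; exact eventually_ge_atTop N
    exact h𝒰 this
  have hA : mkTuple 𝒰 y ∈ limSet 𝒰 A := by
    rw [mkTuple_mem_limSet]
    filter_upwards [hP 0] with n hn using (hy n 0 (Nat.zero_le n) hn).1
  obtain ⟨j, hj⟩ := Set.mem_iUnion.1 (h hA)
  rw [mkTuple_mem_limSet] at hj
  have : ∀ᶠ n in (𝒰 : Filter ℕ), False := by
    filter_upwards [hj, hP (j + 1), hge (j + 1)] with n h1 h2 h3
    exact (hy n (j + 1) h3 h2).2 j (Nat.lt_succ_self j) h1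
  simpa using this.exists

/-- The measure of an internal set is the limit of the densities. -/
theorem loeb_limSet [∀ n, Nonempty (V n)] [∀ n, Finite (V n)] [Finite ι]
    (h𝒰 : (𝒰 : Filter ℕ) ≤ cofinite) (A : ∀ n, Set (ι → V n)) :
    loeb V 𝒰 ι (limSet 𝒰 A) = ulimDensity 𝒰 A := by
  rw [loeb, toMeasure_apply _ _ (measurableSet_limSet A)]
  refine le_antisymm ((OuterMeasure.ofFunction_le _).trans (internalDensity_limSet_le A rfl)) ?_
  rw [loebOuter, OuterMeasure.ofFunction_eq_iInf_mem (P := fun S => ∃ B, limSet 𝒰 B = S)]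
  · refine le_iInf fun t => le_iInf fun ht => le_iInf fun hAt => ?_
    have key : ∀ B : ℕ → ∀ n, Set (ι → V n), (∀ j, limSet 𝒰 (B j) = t j) →
        ulimDensity 𝒰 A ≤ ∑' j, ulimDensity 𝒰 (B j) := by
      intro B hB
      obtain ⟨N, hN⟩ := limSet_cover h𝒰 A B (by simpa only [hB] using hAt)
      refine le_trans ?_ (ENNReal.sum_le_tsum (Finset.range N))
      refine le_of_tendsto_of_tendsto (tendsto_ulimDensity (𝒰 := 𝒰) A)
        (tendsto_finsetSum _ fun j _ => tendsto_ulimDensity (𝒰 := 𝒰) (B j)) ?_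
      filter_upwards [hN] with n hn
      have hc : (A n).ncard ≤ ∑ j ∈ Finset.range N, (B j n).ncard :=
        (Set.ncard_le_ncard hn (Set.toFinite _)).trans
          (Finset.set_ncard_biUnion_le _ _)
      simp only [div_eq_mul_inv, ← Finset.sum_mul]
      gcongr
      exact_mod_cast hc
    refine ENNReal.le_of_forall_pos_le_add fun ε hε hfin => ?_
    have hlt : ∀ j, ∃ B : ∀ n, Set (ι → V n), limSet 𝒰 B = t j ∧
        ulimDensity 𝒰 B ≤ internalDensity (t j) + (ENNReal.ofReal (ε * (1 / 2) ^ (j + 1))) := by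
      intro j
      have hj : internalDensity (t j) ≠ ∞ := ENNReal.ne_top_of_tsum_ne_top hfin.ne j
      have := ENNReal.lt_add_right hj
        (b := ENNReal.ofReal (ε * (1 / 2) ^ (j + 1))) (by
          have : (0 : ℝ) < ε := hε
          simp only [ne_eq, ENNReal.ofReal_eq_zero, not_le]; positivity)
      conv_lhs at this => rw [internalDensity]
      simp only [iInf_lt_iff] at this
      obtain ⟨B, hB, hlt⟩ := this
      exact ⟨B, hB, hlt.le⟩
    choose B hB hBle using hlt
    refine (key B hB).trans ((ENNReal.tsum_le_tsum hBle).trans ?_)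
    rw [ENNReal.tsum_add]
    gcongr
    have hs : HasSum (fun j : ℕ => (ε : ℝ) * (1 / 2) ^ (j + 1)) ε := by
      convert! hasSum_geometric_two.mul_left ((ε : ℝ) * (1 / 2)) using 1
      · funext j
        ring
      · ring
    rw [← ENNReal.ofReal_tsum_of_nonneg (fun j => by positivity) hs.summable, hs.tsum_eq,
      ENNReal.ofReal_coe_nnreal]
  · intro S hS
    simp only [internalDensity, iInf_eq_top]
    exact fun B hB => (hS ⟨B, hB⟩).elim

theorem isProbabilityMeasure_loeb [∀ n, Nonempty (V n)] [∀ n, Finite (V n)] [Finite ι]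
    (h𝒰 : (𝒰 : Filter ℕ) ≤ cofinite) : IsProbabilityMeasure (loeb V 𝒰 ι) := by
  have h0 : (Set.univ : Set (ι → UProd V 𝒰)) = limSet 𝒰 (fun n => (Set.univ : Set (ι → V n))) := by
    ext x
    obtain ⟨y, rfl⟩ := mkTuple_surjective x
    simp [mkTuple_mem_limSet]
  refine ⟨?_⟩
  rw [h0, loeb_limSet h𝒰]
  refine tendsto_nhds_unique (tendsto_ulimDensity (𝒰 := 𝒰) _)
    (tendsto_const_nhds.congr fun n => ?_)
  rw [Set.ncard_univ, Nat.card_fun, Nat.cast_pow, ENNReal.div_self]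
  · exact pow_ne_zero _ (by exact_mod_cast Nat.card_pos.ne')
  · exact ENNReal.pow_ne_top (ENNReal.natCast_ne_top _)

end Ultraproduct

section Collections

variable {k : ℕ}

/-- `ℐ` is subset-free on `[k]`: non-empty, and no member is a proper subset of another. -/
def SubsetFree (ℐ : Finset (Finset (Fin k))) : Prop :=
  ℐ.Nonempty ∧ ∀ I ∈ ℐ, ∀ J ∈ ℐ, ¬ I ⊂ J

/-- `ℐ ≤ 𝒥`: for some bijection `π` of `[k]`, every `I ∈ ℐ` is contained in `π(J)` for some
`J ∈ 𝒥`. -/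
def CollLE (ℐ 𝒥 : Finset (Finset (Fin k))) : Prop :=
  ∃ π : Equiv.Perm (Fin k), ∀ I ∈ ℐ, ∃ J ∈ 𝒥, I ⊆ J.image π

end Collections

section Disc

variable {V : ℕ → Type u} {𝒰 : Ultrafilter ℕ} {k : ℕ}

/-- The σ-algebra `ℬ_{k,ℐ}`, generated by the sets `{x | ∀ I ∈ ℐ, x_I ∈ C I}` with `C I ∈ ℬ_I`. -/
@[reducible] def subAlgebra (V : ℕ → Type u) (𝒰 : Ultrafilter ℕ) (ℐ : Finset (Finset (Fin k))) :
    MeasurableSpace (Fin k → UProd V 𝒰) :=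
  MeasurableSpace.generateFrom
    {S | ∃ C : ∀ I : Finset (Fin k), Set (I → UProd V 𝒰),
      (∀ I ∈ ℐ, MeasurableSet (C I)) ∧ S = {x | ∀ I ∈ ℐ, (fun i : I => x i) ∈ C I}}

/-- `ℬ_{k,ℐ}` is a sub-σ-algebra of `ℬ_k`. -/
lemma subAlgebra_le (ℐ : Finset (Finset (Fin k))) :
    subAlgebra V 𝒰 ℐ ≤ instMeasurableSpaceTuple := by
  refine MeasurableSpace.generateFrom_le ?_
  rintro S ⟨C, hC, rfl⟩
  have hr : ∀ I : Finset (Fin k),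
      Measurable (fun (x : Fin k → UProd V 𝒰) (i : I) => x i) := by
    intro I
    refine measurable_generateFrom ?_
    rintro S ⟨A, rfl⟩
    refine MeasurableSpace.measurableSet_generateFrom ⟨fun n => {y | (fun i : I => y i) ∈ A n}, ?_⟩
    ext x
    obtain ⟨y, rfl⟩ := mkTuple_surjective x
    rw [mkTuple_mem_limSet]
    exact mkTuple_mem_limSet A (fun n (i : I) => y n i)
  simp only [Set.ofPred_forall]
  exact MeasurableSet.iInter fun I => MeasurableSet.iInter fun hI => hr I (hC I hI)

/-- `E` is `Disc_p[ℐ]`: the conditional expectation of its indicator function with respect to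
`ℬ_{k,ℐ}` is constantly equal to `p` (almost everywhere). -/
def Disc [∀ n, Finite (V n)] (p : ℝ) (ℐ : Finset (Finset (Fin k)))
    (E : Set (Fin k → UProd V 𝒰)) : Prop :=
  (loeb V 𝒰 (Fin k))[E.indicator (fun _ => (1 : ℝ)) | subAlgebra V 𝒰 ℐ]
    =ᵐ[loeb V 𝒰 (Fin k)] fun _ => p

/-- `E ⊆ Ω ^ k` is symmetric: invariant under all permutations of the coordinates. -/
def Symmetric (E : Set (Fin k → UProd V 𝒰)) : Prop :=
  ∀ (σ : Equiv.Perm (Fin k)) (x : Fin k → UProd V 𝒰), (x ∘ σ) ∈ E ↔ x ∈ E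

end Disc

end Quasirandom

end

noncomputable section

namespace Quasirandom

/-! The set is the limit of finite relations. On a large finite `V` choose one symmetric sign
function `g` on tuples of each arity `1, …, k`, so quasirandom that it hardly correlates with
products of functions each omitting one coordinate (`exists_signs`). Let `χ(x)` be the product of
`g(x|_I)` over `I ∈ ℐ`, and put `f(x) = p + c ∑_π χ(x ∘ π)`, with `c` so small that `0 ≤ f ≤ 1`.
Then `f` is symmetric, and random rounding replaces it by a symmetric set `A`
(`exists_symmetric_rounding`).

If `ℐ ≰ 𝒥`, then for each `π` some `T = π(I)` lies in no `J ∈ 𝒥`. Every indicator of a condition on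
`x|_J` then omits a coordinate of `T`, and so does every other factor of `χ(x ∘ π)`, since the
images of `ℐ` form an antichain. Quasirandomness of `g` on `T` makes the correlation negligible
(`abs_sum_signProd_mul_le`). Against `χ` itself, a permutation fixing `ℐ` contributes `|V|^k` and
any other one almost nothing (`image_eq_or_exists_forall_not_subset`), so there is no cancellation.
As `χ` is a signed sum of `2^|ℐ|` cylinder indicators, `A` correlates with one of the cylinders of
`ℐ`.

Both random choices succeed by a union bound: at arity `s` there are about `3^(s|V|^(s-1))` tests,
each failing with probability at most `2 exp(-const · |V|^s)`. Finally, `Disc` only has to be tested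
on internal cylinders (`disc_iff`), where it is a statement about limits of finite densities. -/

/-! ### Concentration and random rounding -/

open ProbabilityTheory in
lemma _root_.ProbabilityTheory.HasSubgaussianMGF.mono {Ω : Type*} {mΩ : MeasurableSpace Ω}
    {μ : Measure Ω} {X : Ω → ℝ} {c d : NNReal} (h : HasSubgaussianMGF X c μ) (hcd : c ≤ d) :
    HasSubgaussianMGF X d μ where
  integrable_exp_mul := h.integrable_exp_mul
  mgf_le t := (h.mgf_le t).trans <| by
    have : (c : ℝ) ≤ d := hcd
    gcongr

open ProbabilityTheory in
/-- The centred indicator of a Bernoulli variable is sub-Gaussian. -/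
lemma hasSubgaussianMGF_bernoulli (p : unitInterval) :
    HasSubgaussianMGF (fun b : Bool => (if b then (1 : ℝ) else 0) - p) (1 / 4)
      (bernoulliMeasure true false p) := by
  have hm : Measurable (fun b : Bool => if b then (1 : ℝ) else 0) := measurable_of_finite _
  have h := hasSubgaussianMGF_of_mem_Icc (μ := bernoulliMeasure true false p) (a := 0) (b := 1)
    hm.aemeasurable (ae_of_all _ fun b => by cases b <;> simp)
  have hi : ∫ b, (if b then (1 : ℝ) else 0) ∂(bernoulliMeasure true false p) = p := by
    rw [bernoulliMeasure_def, integral_add_measure (.of_finite) (.of_finite)]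
    simp [integral_smul_nnreal_measure]
    simp [NNReal.smul_def]
  rw [hi] at h
  convert! h using 1
  ext; norm_num

open ProbabilityTheory in
/-- Random rounding: a function with values in `[0, 1]` on a finite set can be replaced by an
indicator function, with a small error against each of finitely many bounded test functions. -/
lemma exists_rounding_of_finite {X Z T : Type*} [Fintype X] [Fintype Z] [Fintype T] (q : X → Z)
    (K : ℕ) (hK : ∀ z, Nat.card {x // q x = z} ≤ K) (F : Z → ℝ)
    (hF : ∀ z, F z ∈ Set.Icc (0 : ℝ) 1)
    (w : T → X → ℝ) (hw : ∀ t x, |w t x| ≤ 1) {ε : ℝ} (hε : 0 < ε)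
    (hT : 2 * Fintype.card T * Real.exp (-(2 * ε ^ 2 * Fintype.card X / K)) < 1) :
    ∃ A : Set Z, ∀ t, |∑ x, (A.indicator 1 (q x) - F (q x)) * w t x| ≤ ε * Fintype.card X := by
  classical
  set N : ℝ := (Fintype.card X : ℝ) with hN
  let μ : Measure (Z → Bool) := Measure.pi fun z => bernoulliMeasure true false ⟨F z, hF z⟩
  let c : T → Z → ℝ := fun t z => ∑ x with q x = z, w t x
  -- The error of test `t`, grouped by the fibres of `q`: a sum of independent terms, one for each
  -- `z`.
  let S : T → (Z → Bool) → ℝ := fun t ω => ∑ z, c t z * ((if ω z then (1 : ℝ) else 0) - F z)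
  have hS : ∀ t ω, S t ω = ∑ x, (({z | ω z = true} : Set Z).indicator 1 (q x) - F (q x)) * w t x := by
    intro t ω
    rw [← Finset.sum_fiberwise (s := Finset.univ) (g := q)]
    refine Finset.sum_congr rfl fun z _ => ?_
    rw [Finset.sum_mul]
    refine Finset.sum_congr rfl fun x hx => ?_
    rw [(Finset.mem_filter.1 hx).2, mul_comm]
    simp [Set.indicator_apply]
  have hfib : ∀ z, ∀ t, |c t z| ≤ (Finset.univ.filter fun x => q x = z).card := by
    intro z t
    refine (Finset.abs_sum_le_sum_abs _ _).trans ((Finset.sum_le_sum fun x _ => hw t x).trans ?_)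
    simp
  have hfib' : ∀ z, ((Finset.univ.filter fun x => q x = z).card : ℝ) ≤ K := by
    intro z
    have := hK z
    rw [Nat.card_eq_fintype_card, Fintype.card_subtype] at this
    exact_mod_cast this
  -- Each `|c t z|` is at most its fibre's size, hence at most `K`, and the fibre sizes add up to
  -- `N`. This yields the variance proxy `K * N / 4`.
  have hc : ∀ t, ∑ z, c t z ^ 2 ≤ K * N := by
    intro t
    have hNsum : N = ∑ z, ((Finset.univ.filter fun x => q x = z).card : ℝ) := by
      rw [hN, ← Finset.card_univ, Finset.card_eq_sum_card_fiberwise (f := q) (t := Finset.univ)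
        (by simp)]
      push_cast; rfl
    rw [hNsum, Finset.mul_sum]
    refine Finset.sum_le_sum fun z _ => ?_
    rw [← sq_abs, sq]
    exact mul_le_mul ((hfib z t).trans (hfib' z)) (hfib z t) (abs_nonneg _) (by positivity)
  have hsub : ∀ t, HasSubgaussianMGF (S t) (Real.toNNReal (K * N / 4)) μ := by
    intro t
    have hind : iIndepFun (fun z (ω : Z → Bool) => c t z * ((if ω z then (1 : ℝ) else 0) - F z)) μ :=
      iIndepFun_pi (X := fun z (b : Bool) => c t z * ((if b then (1 : ℝ) else 0) - F z))
        fun z => (measurable_of_finite _).aemeasurable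
    have h1 : ∀ z, HasSubgaussianMGF
        (fun ω : Z → Bool => c t z * ((if ω z then (1 : ℝ) else 0) - F z))
        (Real.toNNReal (c t z ^ 2) * (1 / 4)) μ := by
      intro z
      have h2 : HasSubgaussianMGF (fun b : Bool => c t z * ((if b then (1 : ℝ) else 0) - F z))
          (Real.toNNReal (c t z ^ 2) * (1 / 4))
          (Measure.map (fun ω : Z → Bool => ω z) μ) := by
        rw [show Measure.map (fun ω : Z → Bool => ω z) μ = bernoulliMeasure true false ⟨F z, hF z⟩
          from (measurePreserving_eval _ z).map_eq]
        convert! (hasSubgaussianMGF_bernoulli ⟨F z, hF z⟩).const_mul (c t z) using 2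
        ext; simp [sq_nonneg]; rfl
      exact HasSubgaussianMGF.of_map (Y := fun ω : Z → Bool => ω z)
        (X := fun b : Bool => c t z * ((if b then (1 : ℝ) else 0) - F z))
        (measurable_pi_apply z).aemeasurable h2
    refine (HasSubgaussianMGF.sum_of_iIndepFun hind (s := Finset.univ) fun z _ => h1 z).mono ?_
    rw [← Finset.sum_mul, ← Real.toNNReal_sum_of_nonneg (fun z _ => sq_nonneg _)]
    have h4 : (1 / 4 : NNReal) = Real.toNNReal (1 / 4) := by
      rw [Real.toNNReal_div zero_le_one]; simp
    rw [h4, ← Real.toNNReal_mul (Finset.sum_nonneg fun z _ => sq_nonneg _)]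
    exact Real.toNNReal_mono (by linarith [hc t])
  have hexp : ∀ {Y : (Z → Bool) → ℝ}, HasSubgaussianMGF Y (Real.toNNReal (K * N / 4)) μ →
      μ.real {ω | ε * N ≤ Y ω} ≤ Real.exp (-(2 * ε ^ 2 * N / K)) := by
    intro Y hY
    refine (hY.measure_ge_le (by positivity)).trans (Real.exp_le_exp.2 (le_of_eq ?_))
    rw [Real.coe_toNNReal _ (by positivity)]
    rcases eq_or_ne (K : ℝ) 0 with h0 | h0
    · simp [h0]
    rcases eq_or_ne N 0 with h1 | h1
    · simp [h1]
    field_simp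
    ring
  let bad : Set (Z → Bool) := ⋃ t, ({ω | ε * N ≤ S t ω} ∪ {ω | ε * N ≤ (-S t) ω})
  have hbad : μ.real bad < 1 := by
    refine lt_of_le_of_lt ?_ hT
    refine (measureReal_iUnion_fintype_le _).trans ?_
    have : ∀ t, μ.real ({ω | ε * N ≤ S t ω} ∪ {ω | ε * N ≤ (-S t) ω}) ≤
        2 * Real.exp (-(2 * ε ^ 2 * N / K)) := fun t =>
      (measureReal_union_le _ _).trans (by
        have := hexp (hsub t)
        have := hexp (hsub t).neg
        linarith)
    refine (Finset.sum_le_sum fun t _ => this t).trans (le_of_eq ?_)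
    simp; ring
  have hne : ∃ ω, ω ∉ bad := by
    by_contra! h
    rw [Set.eq_univ_of_forall h] at hbad
    simp [μ] at hbad
  obtain ⟨ω, hω⟩ := hne
  refine ⟨{z | ω z = true}, fun t => ?_⟩
  rw [← hS]
  simp only [bad, Set.mem_iUnion, Set.mem_union, Set.mem_ofPred_eq, not_exists, not_or, not_le,
    Pi.neg_apply] at hω
  exact abs_le.2 ⟨by linarith [(hω t).2], (hω t).1.le⟩

/-- Only values of `q` matter, so `Z` can be cut down to the finite range. This is needed because
`Multiset V` is infinite. -/
lemma exists_rounding {X Z T : Type*} [Fintype X] [Fintype T] (q : X → Z)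
    (K : ℕ) (hK : ∀ z, Nat.card {x // q x = z} ≤ K) (F : Z → ℝ)
    (hF : ∀ z, F z ∈ Set.Icc (0 : ℝ) 1)
    (w : T → X → ℝ) (hw : ∀ t x, |w t x| ≤ 1) {ε : ℝ} (hε : 0 < ε)
    (hT : 2 * Fintype.card T * Real.exp (-(2 * ε ^ 2 * Fintype.card X / K)) < 1) :
    ∃ A : Set Z, ∀ t, |∑ x, (A.indicator 1 (q x) - F (q x)) * w t x| ≤ ε * Fintype.card X := by
  classical
  have hK' : ∀ z : Set.range q, Nat.card {x // Set.rangeFactorization q x = z} ≤ K := fun z =>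
    le_trans (le_of_eq (Nat.card_congr (Equiv.subtypeEquivRight fun x => by
      simp [Set.rangeFactorization, Subtype.ext_iff]))) (hK z)
  obtain ⟨A, hA⟩ := exists_rounding_of_finite (Set.rangeFactorization q) K hK' (fun z => F z)
    (fun z => hF z) w hw hε hT
  refine ⟨Subtype.val '' A, fun t => ?_⟩
  convert! hA t using 5 with x
  simp [Set.indicator_apply, Set.rangeFactorization]

/-! ### Tuples up to permutation -/

/-- The multiset of the coordinates of a tuple. -/
def tupleMultiset {ι V : Type*} [Fintype ι] (x : ι → V) : Multiset V :=
  (Finset.univ : Finset ι).val.map x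

lemma mem_tupleMultiset {ι V : Type*} [Fintype ι] {x : ι → V} {v : V} :
    v ∈ tupleMultiset x ↔ v ∈ Set.range x := by
  simp [tupleMultiset]

lemma tupleMultiset_comp_equiv {ι κ V : Type*} [Fintype ι] [Fintype κ] (e : ι ≃ κ) (x : κ → V) :
    tupleMultiset (x ∘ e) = tupleMultiset x := by
  rw [tupleMultiset, tupleMultiset, ← Finset.map_univ_equiv e, Finset.map_val, Multiset.map_map]
  rfl

lemma tupleMultiset_restrict {ι V : Type*} (T : Finset ι) (x : ι → V) :
    tupleMultiset (fun i : T => x i) = T.val.map x := by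
  rw [tupleMultiset, Finset.univ_eq_attach, Finset.attach_val]
  exact (Multiset.map_map x Subtype.val T.val.attach).symm.trans
    (congrArg _ (Multiset.attach_map_val T.val))

/-- Each value is attained equally often by both tuples; matching the fibres gives the permutation.
-/
lemma exists_comp_perm_of_tupleMultiset_eq {ι V : Type*} [Fintype ι] {x y : ι → V}
    (h : tupleMultiset x = tupleMultiset y) : ∃ σ : Equiv.Perm ι, x ∘ σ = y := by
  classical
  have hc : ∀ v, Fintype.card {i // y i = v} = Fintype.card {i // x i = v} := by
    intro v
    have := congrArg (Multiset.count v) h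
    simp only [tupleMultiset, Multiset.count_map] at this
    rw [Fintype.card_subtype, Fintype.card_subtype, Finset.card_def, Finset.card_def]
    simp only [Finset.filter_val]
    simpa only [eq_comm] using this.symm
  exact ⟨Equiv.ofFiberEquiv fun v => Fintype.equivOfCardEq (hc v),
    funext fun i => Equiv.ofFiberEquiv_map _ i⟩

/-- All tuples in a fibre take values in the range of any one of them. The bound does not depend on
`V`, so forcing symmetry costs only a constant in the concentration estimate. -/
lemma card_tupleMultiset_fiber_le {ι V : Type*} [Fintype ι] [Finite V] (m : Multiset V) :
    Nat.card {x : ι → V // tupleMultiset x = m} ≤ Fintype.card ι ^ Fintype.card ι := by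
  classical
  rcases isEmpty_or_nonempty {x : ι → V // tupleMultiset x = m} with h | ⟨⟨x₀, hx₀⟩⟩
  · simp
  · let f : {x : ι → V // tupleMultiset x = m} → (ι → Set.range x₀) := fun x i =>
      ⟨x.1 i, mem_tupleMultiset.1 (hx₀.trans x.2.symm ▸ mem_tupleMultiset.2 ⟨i, rfl⟩)⟩
    have hf : Function.Injective f := by
      intro x y hxy
      ext i
      exact congrArg Subtype.val (congrFun hxy i)
    refine (Nat.card_le_card_of_injective f hf).trans ?_
    rw [Nat.card_fun, Nat.card_eq_fintype_card (α := ι)]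
    refine Nat.pow_le_pow_left ?_ _
    rw [← Nat.card_eq_fintype_card (α := ι)]
    exact Finite.card_range_le x₀

/-! ### Quasirandom functions -/

/-- `h` does not depend on the coordinate `i`. -/
def IndepCoord {ι V R : Type*} (i : ι) (h : (ι → V) → R) : Prop :=
  ∀ x y : ι → V, (∀ j, j ≠ i → x j = y j) → h x = h y

/-- `φ` has correlation at most `ε` with all products of sign functions each of which does not
depend on one of the coordinates. -/
def IsQuasirandom {ι V : Type*} [Fintype ι] [DecidableEq ι] [Fintype V] (φ : (ι → V) → ℝ) (ε : ℝ) :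
    Prop :=
  ∀ h : ι → (ι → V) → SignType, (∀ i, IndepCoord i (h i)) →
    |∑ x, φ x * ∏ i, ((h i x : SignType) : ℝ)| ≤ ε * (Fintype.card V : ℝ) ^ Fintype.card ι

lemma coe_prod_signType {α : Type*} (s : Finset α) (f : α → SignType) :
    ((∏ a ∈ s, f a : SignType) : ℝ) = ∏ a ∈ s, (f a : ℝ) :=
  map_prod (SignType.castHom (α := ℝ)) f s

lemma abs_coe_signType_le (a : SignType) : |(a : ℝ)| ≤ 1 := by
  cases a <;> simp

section

variable {ι κ V : Type*} [Fintype ι] [DecidableEq ι] [Fintype κ] [DecidableEq κ] [Fintype V]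

/-- Assign each factor to a coordinate it omits; the factors assigned to one coordinate multiply to
a single sign function omitting it. -/
lemma IsQuasirandom.abs_sum_prod_le {φ : (ι → V) → ℝ} {ε : ℝ} (hφ : IsQuasirandom φ ε)
    {α : Type*} (s : Finset α) (h : α → (ι → V) → SignType)
    (hs : ∀ a ∈ s, ∃ i, IndepCoord i (h a)) :
    |∑ x, φ x * ∏ a ∈ s, (h a x : ℝ)| ≤ ε * (Fintype.card V : ℝ) ^ Fintype.card ι := by
  classical
  rcases s.eq_empty_or_nonempty with rfl | ⟨a₀, ha₀⟩
  · simpa using hφ (fun _ _ => 1) fun _ _ _ _ => rfl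
  have : Nonempty ι := ⟨(hs a₀ ha₀).choose⟩
  choose! c hc using hs
  have key := hφ (fun i x => ∏ a ∈ s with c a = i, h a x) (by
    intro i x y hxy
    refine Finset.prod_congr rfl fun a ha => ?_
    rw [Finset.mem_filter] at ha
    exact hc a ha.1 x y (ha.2 ▸ hxy))
  simp only [coe_prod_signType] at key
  convert! key using 6 with x
  exact (Finset.prod_fiberwise_of_maps_to (fun a _ => Finset.mem_univ (c a)) _).symm

lemma IsQuasirandom.comp_equiv {φ : (ι → V) → ℝ} {ε : ℝ} (hφ : IsQuasirandom φ ε) (e : ι ≃ κ) :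
    IsQuasirandom (fun x : κ → V => φ (x ∘ e)) ε := by
  intro h hh
  have := hφ (fun i x => h (e i) (x ∘ e.symm)) (by
    intro i x y hxy
    refine hh (e i) _ _ fun j hj => hxy _ ?_
    rintro rfl
    simp at hj)
  rw [← Fintype.card_congr e]
  convert! this using 2
  refine Fintype.sum_equiv (Equiv.arrowCongr e.symm (Equiv.refl V)) _ _ fun x => ?_
  congr 1
  rw [← e.prod_comp]
  simp [Equiv.arrowCongr, Function.comp_assoc]

/-- The correlation bound for a function of some of the coordinates. -/
lemma IsQuasirandom.abs_sum_restrict_le {T : Finset ι} {φ : (T → V) → ℝ} {ε : ℝ}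
    (hφ : IsQuasirandom φ ε) {α : Type*} (s : Finset α) (h : α → (ι → V) → SignType)
    (hs : ∀ a ∈ s, ∃ i ∈ T, IndepCoord i (h a)) :
    |∑ x : ι → V, φ (fun i : T => x i) * ∏ a ∈ s, (h a x : ℝ)| ≤
      ε * (Fintype.card V : ℝ) ^ Fintype.card ι := by
  let E := Equiv.piEquivPiSubtypeProd (fun i => i ∈ T) (fun _ : ι => V)
  rw [← E.symm.sum_comp, Fintype.sum_prod_type_right]
  have hE : ∀ (y : T → V) z, (fun i : T => E.symm (y, z) i) = y := by
    intro y z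
    funext i
    simp [E, Equiv.piEquivPiSubtypeProd]
  -- With the coordinates outside `T` frozen at `z`, every factor is a function on `T → V` that
  -- still omits a coordinate of `T`.
  have hb : ∀ z, |∑ y : T → V, φ (fun i : T => E.symm (y, z) i) *
      ∏ a ∈ s, (h a (E.symm (y, z)) : ℝ)| ≤ ε * (Fintype.card V : ℝ) ^ Fintype.card T := by
    intro z
    simp only [hE]
    refine hφ.abs_sum_prod_le s (fun a y => h a (E.symm (y, z))) fun a ha => ?_
    obtain ⟨i, hi, hia⟩ := hs a ha
    refine ⟨⟨i, hi⟩, fun x y hxy => hia _ _ fun j hj => ?_⟩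
    by_cases hjT : j ∈ T
    · simpa [E, Equiv.piEquivPiSubtypeProd, hjT] using hxy ⟨j, hjT⟩ (by simpa using hj)
    · simp [E, Equiv.piEquivPiSubtypeProd, hjT]
  refine (Finset.abs_sum_le_sum_abs _ _).trans ((Finset.sum_le_sum fun z _ => hb z).trans ?_)
  rw [Finset.sum_const, nsmul_eq_mul, Finset.card_univ, Fintype.card_fun, Nat.cast_pow,
    mul_left_comm, ← pow_add, Fintype.card_subtype_compl, Fintype.card_coe, Nat.sub_add_cancel]
  exact Finset.card_le_univ T

end

/-! ### Union bound and symmetric quasirandom relations -/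

/-- The number of tests is negligible compared to the concentration of measure. -/
lemma exists_forall_exp_bound (s : ℕ) (hs : 1 ≤ s) (K : ℕ) (hK : 1 ≤ K) {ε : ℝ} (hε : 0 < ε) :
    ∃ N₀ : ℕ, ∀ N : ℕ, N₀ ≤ N →
      2 * (1 + (3 : ℝ) ^ (s * N ^ (s - 1))) * Real.exp (-(2 * ε ^ 2 * (N : ℝ) ^ s / K)) < 1 := by
  have hK0 : (0 : ℝ) < K := by exact_mod_cast hK
  set c : ℝ := 2 * ε ^ 2 / K with hc
  have hc0 : 0 < c := by positivity
  obtain ⟨N₀, hN₀⟩ := exists_nat_gt ((2 + 2 * s) / c)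
  refine ⟨N₀ + 1, fun N hN => ?_⟩
  have hN1 : (1 : ℝ) ≤ N := by exact_mod_cast (Nat.le_add_left 1 N₀).trans hN
  have hNc : (2 + 2 * s : ℝ) < c * N := by
    rw [div_lt_iff₀ hc0] at hN₀
    have : (N₀ : ℝ) ≤ N := by exact_mod_cast (Nat.le_succ N₀).trans hN
    nlinarith
  have hM : (1 : ℝ) ≤ (N : ℝ) ^ (s - 1) := one_le_pow₀ hN1
  set M : ℝ := (N : ℝ) ^ (s - 1) with hMdef
  have hNs : (N : ℝ) ^ s = N * M := by
    rw [hMdef, ← pow_succ', Nat.sub_add_cancel hs]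
  have h3 : (3 : ℝ) ≤ Real.exp 2 := by linarith [Real.add_one_le_exp (2 : ℝ)]
  have h3' : (3 : ℝ) ^ (s * N ^ (s - 1)) ≤ Real.exp (2 * s * M) := by
    refine (pow_le_pow_left₀ (by norm_num) h3 _).trans (le_of_eq ?_)
    rw [← Real.exp_nat_mul]
    push_cast
    congr 1
    ring
  have h4 : (4 : ℝ) ≤ Real.exp 2 := by
    have := Real.add_one_le_exp (1 : ℝ)
    have h : Real.exp 2 = Real.exp 1 * Real.exp 1 := by rw [← Real.exp_add]; norm_num
    nlinarith
  -- With `M = N ^ (s - 1)` the number of tests is at most `exp ((2 + 2s) M)`, against a tail of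
  -- `exp (-c N M)`; `N₀` was chosen so that `c N > 2 + 2s`.
  have h5 : 2 * (1 + (3 : ℝ) ^ (s * N ^ (s - 1))) ≤ Real.exp (2 * M) * Real.exp (2 * s * M) := by
    have h1 : (1 : ℝ) ≤ Real.exp (2 * s * M) := Real.one_le_exp (by positivity)
    have h2 : (4 : ℝ) ≤ Real.exp (2 * M) := h4.trans (Real.exp_le_exp.2 (by linarith))
    nlinarith
  refine (mul_le_mul_of_nonneg_right h5 (Real.exp_pos _).le).trans_lt ?_
  rw [← Real.exp_add, ← Real.exp_add, Real.exp_lt_one_iff, hNs]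
  have : 2 * ε ^ 2 * (N * M) / K = c * N * M := by rw [hc]; ring
  rw [this]
  nlinarith

/-- A symmetric function with values in `[0, 1]` can be replaced by a symmetric set. -/
lemma exists_symmetric_rounding (s : ℕ) (hs : 1 ≤ s) {ε : ℝ} (hε : 0 < ε) :
    ∃ N₀ : ℕ, ∀ {V : Type*} [Fintype V], N₀ ≤ Fintype.card V → ∀ F : Multiset V → ℝ,
      (∀ m, F m ∈ Set.Icc (0 : ℝ) 1) → ∀ w : (Fin s → V) → ℝ, (∀ x, |w x| ≤ 1) →
      ∃ A : Set (Multiset V),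
        IsQuasirandom (fun x : Fin s → V =>
          A.indicator 1 (tupleMultiset x) - F (tupleMultiset x)) ε ∧
        |∑ x : Fin s → V, (A.indicator 1 (tupleMultiset x) - F (tupleMultiset x)) * w x| ≤
          ε * (Fintype.card V : ℝ) ^ s := by
  classical
  obtain ⟨N₀, hN₀⟩ := exists_forall_exp_bound s hs (s ^ s) (Nat.one_le_pow _ _ hs) hε
  refine ⟨N₀ + 1, fun {V} _ hV F hF w hw => ?_⟩
  have hVne : Nonempty V := Fintype.card_pos_iff.1 (by omega)
  let v₀ : V := Classical.arbitrary V
  let ext : ∀ i : Fin s, ({j // j ≠ i} → V) → Fin s → V :=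
    fun i y j => if hj : j ≠ i then y ⟨j, hj⟩ else v₀
  -- The tests: `none` is the extra weight `w`, and `some h` a family of sign functions of the `s -
  -- 1` coordinates other than `i`. The padding value `v₀` in `ext` is immaterial.
  let T := Option (∀ i : Fin s, ({j // j ≠ i} → V) → SignType)
  let W : T → (Fin s → V) → ℝ := fun t x =>
    t.elim (w x) fun h => ∏ i, ((h i fun j => x j : SignType) : ℝ)
  have hW : ∀ t x, |W t x| ≤ 1 := by
    rintro (_ | h) x
    · exact hw x
    · simp only [W, Option.elim, Finset.abs_prod]
      exact Finset.prod_le_one (fun _ _ => abs_nonneg _) fun i _ => abs_coe_signType_le _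
  obtain ⟨A, hA⟩ := exists_rounding (tupleMultiset (ι := Fin s) (V := V)) (s ^ s)
    (fun m => by simpa using card_tupleMultiset_fiber_le (ι := Fin s) m) F hF W hW hε (by
      have := hN₀ (Fintype.card V) (by omega)
      convert! this using 5
      · have h3 : Fintype.card SignType = 3 := rfl
        have h4 : ∀ i : Fin s, Fintype.card {j // ¬ j = i} = s - 1 := fun i => by
          rw [Fintype.card_subtype_compl]; simp
        simp only [T, Fintype.card_option, Fintype.card_pi, Finset.prod_const, Finset.card_univ, h3,
          ne_eq, h4, Fintype.card_fin]
        push_cast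
        rw [← pow_mul, mul_comm s, add_comm]
      · simp)
  refine ⟨A, fun h hh => ?_, by simpa [W] using hA none⟩
  have := hA (some fun i y => h i (ext i y))
  have hext : ∀ i x, h i (ext i fun j => x j) = h i x := fun i x =>
    hh i _ _ fun j hj => by simp [ext, hj]
  simp only [W, Option.elim, Fintype.card_fun, Nat.cast_pow, hext] at this
  exact this

/-- There are quasirandom symmetric sign functions in all arities up to `k` simultaneously. -/
lemma exists_signs (k : ℕ) {ε : ℝ} (hε : 0 < ε) :
    ∃ N₀ : ℕ, ∀ {V : Type*} [Fintype V], N₀ ≤ Fintype.card V → ∃ g : Multiset V → SignType,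
      (∀ m, g m = 1 ∨ g m = -1) ∧ ∀ T : Finset (Fin k), T.Nonempty →
        IsQuasirandom (fun y : T → V => (g (tupleMultiset y) : ℝ)) ε := by
  classical
  have h := fun s : ℕ => exists_symmetric_rounding (s + 1) (Nat.le_add_left 1 s) (half_pos hε)
  choose N hN using h
  refine ⟨(Finset.range k).sup N, fun {V} _ hV => ?_⟩
  have h : ∀ s, ∃ A : Set (Multiset V), s < k → IsQuasirandom (fun x : Fin (s + 1) → V =>
      A.indicator 1 (tupleMultiset x) - (1 / 2 : ℝ)) (ε / 2) := by
    intro s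
    by_cases hs : s < k
    · obtain ⟨A, hA, -⟩ := hN s ((Finset.le_sup (Finset.mem_range.2 hs)).trans hV) (fun _ => 1 / 2)
        (fun _ => by norm_num) (fun _ => 0) (by simp)
      exact ⟨A, fun _ => hA⟩
    · exact ⟨∅, fun h => (hs h).elim⟩
  choose A hA using h
  -- The set `A s` governs arity `s + 1`, hence the shift by one; the empty multiset is never used.
  refine ⟨fun m => if m ∈ A (m.card - 1) then 1 else -1, fun m => by
    by_cases hm : m ∈ A (m.card - 1) <;> simp [hm], fun T hT => ?_⟩
  have hTk : T.card - 1 < k := by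
    have h1 := Finset.card_pos.2 hT
    have h2 := Finset.card_le_univ T
    rw [Fintype.card_fin] at h2
    omega
  have e : Fin (T.card - 1 + 1) ≃ T := Fintype.equivOfCardEq (by
    have h1 := Finset.card_pos.2 hT
    simp; omega)
  have key := (hA _ hTk).comp_equiv e
  intro f hf
  have := key f hf
  -- The sign is twice the centred indicator, which is why the rounding was done with `ε / 2`.
  have h2 : ∀ y : T → V, (((if tupleMultiset y ∈ A ((tupleMultiset y).card - 1) then 1 else -1 :
      SignType)) : ℝ) =
      2 * ((A (T.card - 1)).indicator 1 (tupleMultiset (y ∘ e)) - (1 / 2 : ℝ)) := by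
    intro y
    have hc : (tupleMultiset y).card = T.card := by
      rw [tupleMultiset, Multiset.card_map, Finset.card_val, Finset.card_univ, Fintype.card_coe]
    rw [hc, tupleMultiset_comp_equiv]
    by_cases hm : tupleMultiset y ∈ A (T.card - 1)
    · simp [hm]; norm_num
    · simp [hm]
  simp only [h2, mul_assoc, ← Finset.mul_sum, abs_mul, abs_two]
  linarith

/-! ### Antichains, products of signs and cylinders -/

lemma SubsetFree.nonempty_of_mem {k : ℕ} {ℐ : Finset (Finset (Fin k))} (hℐ : SubsetFree ℐ)
    (hℐ' : ℐ ≠ {∅}) {I : Finset (Fin k)} (hI : I ∈ ℐ) : I.Nonempty := by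
  rw [Finset.nonempty_iff_ne_empty]
  rintro rfl
  refine hℐ' (Finset.eq_singleton_iff_unique_mem.2 ⟨hI, fun J hJ => ?_⟩)
  by_contra hne
  exact hℐ.2 _ hI J hJ (Finset.empty_ssubset.2 (Finset.nonempty_iff_ne_empty.2 hne))

/-- A permutation that maps each member of an antichain into a member of the antichain preserves
the antichain. -/
lemma image_eq_or_exists_forall_not_subset {k : ℕ} {ℐ : Finset (Finset (Fin k))}
    (hℐ : ∀ I ∈ ℐ, ∀ J ∈ ℐ, ¬ I ⊂ J) (π : Equiv.Perm (Fin k)) :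
    ℐ.image (Finset.image π) = ℐ ∨ ∃ T ∈ ℐ.image (Finset.image π), ∀ I ∈ ℐ, ¬ T ⊆ I := by
  by_contra! h
  obtain ⟨hne, h⟩ := h
  have hinj : Function.Injective (Finset.image π) := Finset.image_injective π.injective
  -- The down-closure of `ℐ`. By assumption `π` maps it into itself, hence onto itself by
  -- finiteness, so `π` permutes its maximal elements, which are the members of `ℐ`.
  let D : Finset (Finset (Fin k)) := Finset.univ.filter fun T => ∃ I ∈ ℐ, T ⊆ I
  have hD : ∀ T, T ∈ D ↔ ∃ I ∈ ℐ, T ⊆ I := fun T => by simp [D]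
  have hDD : D.image (Finset.image π) = D := by
    refine Finset.eq_of_subset_of_card_le ?_ (Finset.card_image_of_injective D hinj).ge
    intro T hT
    obtain ⟨T', hT', rfl⟩ := Finset.mem_image.1 hT
    obtain ⟨I, hI, hTI⟩ := (hD _).1 hT'
    obtain ⟨J, hJ, hIJ⟩ := h _ (Finset.mem_image_of_mem _ hI)
    exact (hD _).2 ⟨J, hJ, (Finset.image_subset_image hTI).trans hIJ⟩
  refine hne (Finset.eq_of_subset_of_card_le (t := ℐ.image (Finset.image π)) (fun I hI => ?_)
    (Finset.card_image_of_injective ℐ hinj).le).symm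
  have hID : I ∈ D.image (Finset.image π) := by
    rw [hDD]; exact (hD I).2 ⟨I, hI, subset_rfl⟩
  obtain ⟨T, hT, rfl⟩ := Finset.mem_image.1 hID
  obtain ⟨I₁, hI₁, hT₁⟩ := (hD T).1 hT
  obtain ⟨I₂, hI₂, h₂⟩ := h _ (Finset.mem_image_of_mem _ hI₁)
  have h₁ := Finset.image_subset_image (f := π) hT₁
  have heq : T.image π = I₂ := by
    by_contra hne'
    exact hℐ _ hI _ hI₂ ((h₁.trans h₂).ssubset_of_ne hne')
  have : T.image π = I₁.image π := h₁.antisymm (h₂.trans heq.ge)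
  exact this ▸ Finset.mem_image_of_mem _ hI₁

section

variable {k : ℕ} {V : Type*}

/-- The product of the signs of the restrictions of a tuple to the members of a collection. -/
def signProd (g : Multiset V → SignType) (ℐ : Finset (Finset (Fin k))) (x : Fin k → V) : SignType :=
  ∏ I ∈ ℐ, g (I.val.map x)

lemma indepCoord_sign (g : Multiset V → SignType) {I : Finset (Fin k)} {i : Fin k} (hi : i ∉ I) :
    IndepCoord i (fun x : Fin k → V => g (I.val.map x)) := fun _ _ hxy =>
  congrArg g (Multiset.map_congr rfl fun j hj => hxy j fun h => hi (h ▸ hj))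

lemma signProd_comp (g : Multiset V → SignType) (ℐ : Finset (Finset (Fin k)))
    (π : Equiv.Perm (Fin k)) (x : Fin k → V) :
    signProd g ℐ (x ∘ π) = signProd g (ℐ.image (Finset.image π)) x := by
  rw [signProd, signProd, Finset.prod_image (Finset.image_injective π.injective).injOn]
  refine Finset.prod_congr rfl fun I _ => ?_
  rw [Finset.image_val_of_injOn π.injective.injOn, Multiset.map_map]

lemma signProd_mul_self {g : Multiset V → SignType} (hg : ∀ m, g m = 1 ∨ g m = -1)
    (ℐ : Finset (Finset (Fin k))) (x : Fin k → V) :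
    (signProd g ℐ x : ℝ) * (signProd g ℐ x : ℝ) = 1 := by
  rw [signProd, coe_prod_signType, ← Finset.prod_mul_distrib]
  refine Finset.prod_eq_one fun I _ => ?_
  rcases hg (I.val.map x) with h | h <;> simp [h]

/-- By the antichain property no other member of `ℐ` contains `T`, so every factor besides `g
(x|_T)` omits a coordinate of `T` and can serve as a test against it. -/
lemma abs_sum_signProd_mul_le [Fintype V] {g : Multiset V → SignType} {ε : ℝ}
    {ℐ : Finset (Finset (Fin k))} (hℐ : ∀ I ∈ ℐ, ∀ J ∈ ℐ, ¬ I ⊂ J) {T : Finset (Fin k)}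
    (hg : IsQuasirandom (fun y : T → V => (g (tupleMultiset y) : ℝ)) ε) (hT : T ∈ ℐ)
    {α : Type*} (s : Finset α) (h : α → (Fin k → V) → SignType)
    (hs : ∀ a ∈ s, ∃ i ∈ T, IndepCoord i (h a)) :
    |∑ x : Fin k → V, (signProd g ℐ x : ℝ) * ∏ a ∈ s, (h a x : ℝ)| ≤
      ε * (Fintype.card V : ℝ) ^ k := by
  classical
  have := hg.abs_sum_restrict_le ((ℐ.erase T).disjSum s)
    (Sum.elim (fun I x => g (I.val.map x)) h) (by
      rintro (I | a) hI
      · simp only [Finset.inl_mem_disjSum, Finset.mem_erase] at hI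
        obtain ⟨i, hi, hiI⟩ := Finset.not_subset.1
          (fun hTI : T ⊆ I => hℐ T hT I hI.2 (hTI.ssubset_of_ne hI.1.symm))
        exact ⟨i, hi, indepCoord_sign g hiI⟩
      · exact hs a (by simpa using hI))
  simp only [tupleMultiset_restrict, Finset.prod_disjSum, Sum.elim_inl, Sum.elim_inr,
    Fintype.card_fin, ← mul_assoc] at this
  simpa only [signProd, coe_prod_signType,
    ← Finset.mul_prod_erase ℐ (fun I => (g (I.val.map _) : ℝ)) hT] using this

/-- The set of the tuples whose restriction to each member `J` of a collection lies in `C J`. -/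
def cylinder (𝒥 : Finset (Finset (Fin k))) (C : ∀ J : Finset (Fin k), Set (J → V)) :
    Set (Fin k → V) :=
  {x | ∀ J ∈ 𝒥, (fun j : J => x j) ∈ C J}

open Classical in
/-- The indicator function of the condition that the restriction to `J` lies in `C J`. -/
def restrictSign (C : ∀ J : Finset (Fin k), Set (J → V)) (J : Finset (Fin k)) (x : Fin k → V) :
    SignType :=
  if (fun j : J => x j) ∈ C J then 1 else 0

lemma indepCoord_restrictSign (C : ∀ J : Finset (Fin k), Set (J → V)) {J : Finset (Fin k)}
    {i : Fin k} (hi : i ∉ J) : IndepCoord i (restrictSign C J) := fun x y hxy => by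
  have : (fun j : J => x j) = fun j : J => y j :=
    funext fun j => hxy j fun h => hi (h ▸ j.2)
  unfold restrictSign
  rw [this]

/-- Since `SignType` contains `0`, the same tests that handle signs also handle indicators. -/
lemma indicator_cylinder (𝒥 : Finset (Finset (Fin k))) (C : ∀ J : Finset (Fin k), Set (J → V))
    (x : Fin k → V) :
    (cylinder 𝒥 C).indicator (1 : (Fin k → V) → ℝ) x = ∏ J ∈ 𝒥, (restrictSign C J x : ℝ) := by
  by_cases hx : x ∈ cylinder 𝒥 C
  · rw [Set.indicator_of_mem hx, Finset.prod_eq_one fun J hJ => ?_]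
    · rfl
    · simp [restrictSign, hx J hJ]
  · rw [Set.indicator_of_notMem hx]
    simp only [cylinder, Set.mem_ofPred_eq, not_forall] at hx
    obtain ⟨J, hJ, hxJ⟩ := hx
    exact (Finset.prod_eq_zero hJ (by simp [restrictSign, hxJ])).symm

lemma ncard_inter_sub_eq_sum {X : Type*} [Fintype X] (A S : Set X) (p : ℝ) :
    ((A ∩ S).ncard : ℝ) - p * S.ncard = ∑ x, (A.indicator 1 x - p) * S.indicator 1 x := by
  classical
  have h : ∀ B : Set X, (B.ncard : ℝ) = ∑ x, B.indicator 1 x := by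
    intro B
    rw [Set.ncard_eq_toFinset_card' B, Finset.card_eq_sum_ones]
    push_cast
    rw [← Finset.sum_indicator_subset _ (Finset.subset_univ _)]
    simp [Set.indicator_apply]
  rw [h, h, Finset.mul_sum, ← Finset.sum_sub_distrib]
  refine Finset.sum_congr rfl fun x _ => ?_
  rw [Set.inter_indicator_one, Pi.mul_apply, sub_mul]

/-- If a function is correlated with a product of signs, then it is correlated with one of the sets
on which all the signs are constant. -/
lemma exists_le_abs_sum_cylinder [Fintype V] {g : Multiset V → SignType}
    (hg : ∀ m, g m = 1 ∨ g m = -1) (ℐ : Finset (Finset (Fin k))) (ψ : (Fin k → V) → ℝ) :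
    ∃ C : ∀ I : Finset (Fin k), Set (I → V),
      |∑ x, ψ x * (signProd g ℐ x : ℝ)| / 2 ^ ℐ.card ≤
        |∑ x, ψ x * (cylinder ℐ C).indicator 1 x| := by
  classical
  -- For `t ⊆ ℐ` this cylinder is the set of `x` where `g (x|_I)` is `1` exactly for `I ∈ t`. These
  -- `2 ^ ℐ.card` sets partition the tuples, and the product of signs is constant on each.
  let C : Finset (Finset (Fin k)) → ∀ I : Finset (Fin k), Set (I → V) := fun t I =>
    {y | g (tupleMultiset y) = 1 ↔ I ∈ t}
  by_contra! hlt
  have hcyl : ∀ t x, x ∈ cylinder ℐ (C t) ↔ ∀ I ∈ ℐ, (g (I.val.map x) = 1 ↔ I ∈ t) := by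
    intro t x
    simp only [cylinder, C, Set.mem_ofPred_eq, tupleMultiset_restrict]
  have hsum : ∑ x, ψ x * (signProd g ℐ x : ℝ) = ∑ t ∈ ℐ.powerset,
      (∏ I ∈ ℐ, if I ∈ t then (1 : ℝ) else -1) *
        ∑ x, ψ x * (cylinder ℐ (C t)).indicator 1 x := by
    simp only [Finset.mul_sum]
    rw [Finset.sum_comm]
    refine Finset.sum_congr rfl fun x _ => ?_
    have hu : ∀ t ∈ ℐ.powerset, x ∈ cylinder ℐ (C t) ↔
        t = ℐ.filter fun I => g (I.val.map x) = 1 := by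
      intro t ht
      rw [hcyl]
      constructor
      · intro h
        ext I
        rw [Finset.mem_filter]
        exact ⟨fun hI => ⟨Finset.mem_powerset.1 ht hI, (h I (Finset.mem_powerset.1 ht hI)).2 hI⟩,
          fun hI => (h I hI.1).1 hI.2⟩
      · rintro rfl I hI
        simp [hI]
    rw [Finset.sum_eq_single_of_mem (ℐ.filter fun I => g (I.val.map x) = 1)
      (Finset.mem_powerset.2 (Finset.filter_subset _ _))]
    · rw [Set.indicator_of_mem ((hu _ (Finset.mem_powerset.2 (Finset.filter_subset _ _))).2 rfl),
        signProd, coe_prod_signType, Pi.one_apply, mul_one, mul_comm]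
      congr 1
      refine Finset.prod_congr rfl fun I hI => ?_
      rcases hg (I.val.map x) with h | h <;> simp [h, hI]
    · intro t ht hne
      rw [Set.indicator_of_notMem (fun h => hne ((hu t ht).1 h)), mul_zero, mul_zero]
  have hle : |∑ x, ψ x * (signProd g ℐ x : ℝ)| ≤
      ∑ t ∈ ℐ.powerset, |∑ x, ψ x * (cylinder ℐ (C t)).indicator 1 x| := by
    rw [hsum]
    refine (Finset.abs_sum_le_sum_abs _ _).trans (Finset.sum_le_sum fun t _ => ?_)
    rw [abs_mul, Finset.abs_prod]
    refine mul_le_of_le_one_left (abs_nonneg _) (Finset.prod_le_one (fun _ _ => abs_nonneg _)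
      fun I _ => ?_)
    split_ifs <;> simp
  have hlt' := Finset.sum_lt_sum_of_nonempty (Finset.powerset_nonempty ℐ) fun t _ => hlt (C t)
  rw [Finset.sum_const, Finset.card_powerset, nsmul_eq_mul, Nat.cast_pow, Nat.cast_two,
    mul_div_cancel₀ _ (by positivity)] at hlt'
  exact absurd hle (not_le.2 hlt')

end

/-! ### The finite separation -/

open Nat in
/-- Finite version: in a large finite set there is a symmetric `k`-ary relation of density about `p`
that is almost uncorrelated with the cylinder sets of all collections not above `ℐ`, but correlated
with a cylinder set of `ℐ`. -/
theorem exists_finite_separation {k : ℕ} {ℐ : Finset (Finset (Fin k))} (hℐ : SubsetFree ℐ)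
    (hℐ' : ℐ ≠ {∅}) {p : ℝ} (hp0 : 0 < p) (hp1 : p < 1) :
    ∃ δ > 0, ∀ ε > 0, ∃ N₀ : ℕ, ∀ {V : Type*} [Finite V], N₀ ≤ Nat.card V →
      ∃ A : Set (Fin k → V), (∀ (σ : Equiv.Perm (Fin k)) x, x ∘ σ ∈ A ↔ x ∈ A) ∧
        (∀ 𝒥 : Finset (Finset (Fin k)), ¬ CollLE ℐ 𝒥 → ∀ C : ∀ J : Finset (Fin k), Set (J → V),
          |((A ∩ cylinder 𝒥 C).ncard : ℝ) - p * (cylinder 𝒥 C).ncard| ≤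
            ε * (Nat.card V : ℝ) ^ k) ∧
        ∃ C : ∀ J : Finset (Fin k), Set (J → V), δ * (Nat.card V : ℝ) ^ k ≤
          |((A ∩ cylinder ℐ C).ncard : ℝ) - p * (cylinder ℐ C).ncard| := by
  classical
  have hne : ∀ I ∈ ℐ, I.Nonempty := fun I hI => hℐ.nonempty_of_mem hℐ' hI
  have hk : 1 ≤ k := by
    obtain ⟨I, hI⟩ := hℐ.1
    obtain ⟨i, -⟩ := hne I hI
    exact Nat.one_le_iff_ne_zero.2 fun h => Nat.not_lt_zero i.1 (h ▸ i.2)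
  have hk! : (0 : ℝ) < k ! := by exact_mod_cast k.factorial_pos
  set c : ℝ := min p (1 - p) / k ! with hc
  have hmin : 0 < min p (1 - p) := lt_min hp0 (sub_pos.2 hp1)
  have hc0 : 0 < c := by positivity
  have hck : c * k ! = min p (1 - p) := div_mul_cancel₀ _ hk!.ne'
  have hck1 : c * k ! ≤ p := hck.trans_le (min_le_left _ _)
  have hck2 : c * k ! ≤ 1 - p := hck.trans_le (min_le_right _ _)
  -- The correlation with the product of signs will be at least `c / 2`; passing to one cylinder
  -- loses the factor `2 ^ ℐ.card`.
  refine ⟨c / 2 / 2 ^ ℐ.card, by positivity, fun ε hε => ?_⟩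
  set η : ℝ := min (c / 4) (ε / 2) with hη
  have hη0 : 0 < η := lt_min (by positivity) (by positivity)
  have hη1 : η ≤ c / 4 := min_le_left _ _
  have hη2 : η ≤ ε / 2 := min_le_right _ _
  obtain ⟨N₁, hN₁⟩ := exists_signs k hη0
  obtain ⟨N₂, hN₂⟩ := exists_symmetric_rounding k hk hη0
  refine ⟨max N₁ N₂, fun {V} _ hV => ?_⟩
  cases nonempty_fintype V
  simp only [Nat.card_eq_fintype_card] at hV ⊢
  obtain ⟨g, hg, hgq⟩ := hN₁ ((le_max_left _ _).trans hV)
  set M : ℝ := (Fintype.card V : ℝ) ^ k with hM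
  have hM0 : 0 ≤ M := by positivity
  let f : (Fin k → V) → ℝ := fun x => p + c * ∑ π : Equiv.Perm (Fin k), (signProd g ℐ (x ∘ π) : ℝ)
  have hf : ∀ x, f x ∈ Set.Icc (0 : ℝ) 1 := by
    intro x
    have h1 : |∑ π : Equiv.Perm (Fin k), (signProd g ℐ (x ∘ π) : ℝ)| ≤ k ! := by
      refine (Finset.abs_sum_le_sum_abs _ _).trans
        ((Finset.sum_le_sum fun π _ => abs_coe_signType_le _).trans (le_of_eq ?_))
      simp [Fintype.card_perm]
    obtain ⟨h2, h3⟩ := abs_le.1 h1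
    have h4 := mul_le_mul_of_nonneg_left h2 hc0.le
    have h5 := mul_le_mul_of_nonneg_left h3 hc0.le
    constructor <;> simp only [f] <;> linarith
  have hfσ : ∀ x (σ : Equiv.Perm (Fin k)), f (x ∘ σ) = f x := by
    intro x σ
    simp only [f]
    rw [← Equiv.sum_comp (Equiv.mulLeft σ) (fun π : Equiv.Perm (Fin k) => (signProd g ℐ (x ∘ π) : ℝ))]
    rfl
  -- The symmetric `f` descends to multisets; the value `p` elsewhere only keeps `F` in `[0, 1]`.
  let F : Multiset V → ℝ := Function.extend tupleMultiset f fun _ => p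
  have hfac : Function.FactorsThrough f (tupleMultiset (ι := Fin k) (V := V)) := by
    intro x y hxy
    obtain ⟨σ, rfl⟩ := exists_comp_perm_of_tupleMultiset_eq hxy
    exact (hfσ x σ).symm
  have hFf : ∀ x, F (tupleMultiset x) = f x := fun x => hfac.extend_apply _ x
  have hF : ∀ m, F m ∈ Set.Icc (0 : ℝ) 1 := by
    intro m
    by_cases hm : ∃ x : Fin k → V, tupleMultiset x = m
    · obtain ⟨x, rfl⟩ := hm
      rw [hFf]
      exact hf x
    · simp only [F]
      rw [Function.extend_apply' _ _ _ hm]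
      exact ⟨hp0.le, hp1.le⟩
  obtain ⟨B, hB, hBw⟩ := hN₂ ((le_max_right _ _).trans hV) F hF
    (fun x => (signProd g ℐ x : ℝ)) fun x => abs_coe_signType_le _
  simp only [hFf] at hB hBw
  let A : Set (Fin k → V) := {x | tupleMultiset x ∈ B}
  have hsplit : ∀ w : (Fin k → V) → ℝ, ∑ x, (A.indicator 1 x - p) * w x =
      ∑ x, (B.indicator 1 (tupleMultiset x) - f x) * w x +
        c * ∑ π : Equiv.Perm (Fin k), ∑ x, (signProd g ℐ (x ∘ π) : ℝ) * w x := by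
    intro w
    rw [Finset.sum_comm, Finset.mul_sum, ← Finset.sum_add_distrib]
    refine Finset.sum_congr rfl fun x _ => ?_
    have : A.indicator (1 : (Fin k → V) → ℝ) x = B.indicator 1 (tupleMultiset x) := by
      simp [Set.indicator_apply, A]
    rw [this, ← Finset.sum_mul]
    simp only [f]
    ring
  have hanti : ∀ π : Equiv.Perm (Fin k), ∀ I ∈ ℐ.image (Finset.image π),
      ∀ J ∈ ℐ.image (Finset.image π), ¬ I ⊂ J := by
    intro π I hI J hJ
    obtain ⟨I', hI', rfl⟩ := Finset.mem_image.1 hI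
    obtain ⟨J', hJ', rfl⟩ := Finset.mem_image.1 hJ
    rw [Finset.image_ssubset_image π.injective]
    exact hℐ.2 I' hI' J' hJ'
  have hπne : ∀ π : Equiv.Perm (Fin k), ∀ I ∈ ℐ.image (Finset.image π), I.Nonempty := by
    intro π I hI
    obtain ⟨I', hI', rfl⟩ := Finset.mem_image.1 hI
    exact (hne I' hI').image _
  refine ⟨A, fun σ x => ?_, fun 𝒥 h𝒥 C => ?_, ?_⟩
  · simp only [A, Set.mem_ofPred_eq, tupleMultiset_comp_equiv]
  · rw [ncard_inter_sub_eq_sum, hsplit]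
    simp only [indicator_cylinder]
    have h1 : |∑ x, (B.indicator 1 (tupleMultiset x) - f x) *
        ∏ J ∈ 𝒥, (restrictSign C J x : ℝ)| ≤ η * M := by
      have := hB.abs_sum_prod_le 𝒥 (restrictSign C) fun J hJ => by
        by_contra! h
        -- A `J` omitting no coordinate would be all of `[k]`, which contains every `I`, giving `ℐ ≤
        -- 𝒥`.
        refine h𝒥 ⟨1, fun I _ => ⟨J, hJ, ?_⟩⟩
        have hJu : J = Finset.univ := Finset.eq_univ_iff_forall.2 fun i => by
          by_contra hi
          exact h i (indepCoord_restrictSign C hi)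
        simp [hJu]
      simpa using this
    have h2 : ∀ π : Equiv.Perm (Fin k), |∑ x, (signProd g ℐ (x ∘ π) : ℝ) *
        ∏ J ∈ 𝒥, (restrictSign C J x : ℝ)| ≤ η * M := by
      intro π
      have : ∃ T ∈ ℐ.image (Finset.image π), ∀ J ∈ 𝒥, ¬ T ⊆ J := by
        by_contra! h
        refine h𝒥 ⟨π.symm, fun I hI => ?_⟩
        obtain ⟨J, hJ, hIJ⟩ := h _ (Finset.mem_image_of_mem _ hI)
        refine ⟨J, hJ, fun i hi => Finset.mem_image.2 ⟨π i, hIJ (Finset.mem_image_of_mem _ hi), ?_⟩⟩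
        simp
      obtain ⟨T, hT, hTJ⟩ := this
      simp only [signProd_comp]
      refine abs_sum_signProd_mul_le (hanti π) (hgq T (hπne π T hT)) hT 𝒥 (restrictSign C)
        fun J hJ => ?_
      obtain ⟨i, hi, hiJ⟩ := Finset.not_subset.1 (hTJ J hJ)
      exact ⟨i, hi, indepCoord_restrictSign C hiJ⟩
    have h3 : |∑ π : Equiv.Perm (Fin k), ∑ x, (signProd g ℐ (x ∘ π) : ℝ) *
        ∏ J ∈ 𝒥, (restrictSign C J x : ℝ)| ≤ k ! * (η * M) := by
      refine (Finset.abs_sum_le_sum_abs _ _).trans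
        ((Finset.sum_le_sum fun π _ => h2 π).trans (le_of_eq ?_))
      simp [Fintype.card_perm]
    refine (abs_add_le _ _).trans ?_
    rw [abs_mul, abs_of_pos hc0]
    have h4 := mul_le_mul_of_nonneg_left h3 hc0.le
    have h5 : c * (k ! * (η * M)) ≤ η * M := by
      rw [← mul_assoc]
      exact mul_le_of_le_one_left (by positivity) (by linarith)
    have h6 := mul_le_mul_of_nonneg_right hη2 hM0
    linarith
  · obtain ⟨C, hC⟩ := exists_le_abs_sum_cylinder hg ℐ fun x => A.indicator 1 x - p
    refine ⟨C, ?_⟩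
    rw [ncard_inter_sub_eq_sum]
    refine le_trans ?_ hC
    rw [div_mul_eq_mul_div]
    refine div_le_div_of_nonneg_right (le_trans ?_ (le_abs_self _)) (by positivity)
    rw [hsplit]
    -- Every permutation preserving `ℐ` contributes exactly `M`; crediting only the identity is
    -- enough, as all other terms are at least `-η * M`.
    have h1 : ∑ π : Equiv.Perm (Fin k), ((if π = 1 then M else 0) - η * M) ≤
        ∑ π : Equiv.Perm (Fin k), ∑ x, (signProd g ℐ (x ∘ π) : ℝ) * (signProd g ℐ x : ℝ) := by
      refine Finset.sum_le_sum fun π _ => ?_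
      have hηM : 0 ≤ η * M := by positivity
      have hself : ∑ x : Fin k → V, (signProd g ℐ x : ℝ) * (signProd g ℐ x : ℝ) = M := by
        simp [signProd_mul_self hg, hM]
      simp only [signProd_comp]
      rcases image_eq_or_exists_forall_not_subset hℐ.2 π with h | ⟨T, hT, hTI⟩
      · rw [h, hself]
        split_ifs <;> linarith
      · have hπ : π ≠ 1 := by
          rintro rfl
          have : ℐ.image (Finset.image (1 : Equiv.Perm (Fin k))) = ℐ := by
            ext; simp
          rw [this] at hT
          exact hTI T hT subset_rfl
        have := abs_sum_signProd_mul_le (hanti π) (hgq T (hπne π T hT)) hT ℐ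
          (fun I x => g (I.val.map x)) fun I hI => by
            obtain ⟨i, hi, hiI⟩ := Finset.not_subset.1 (hTI I hI)
            exact ⟨i, hi, indepCoord_sign g hiI⟩
        simp only [← coe_prod_signType] at this
        rw [if_neg hπ, zero_sub]
        exact (abs_le.1 this).1
    have h2 : ∑ π : Equiv.Perm (Fin k), ((if π = 1 then M else 0) - η * M) = M - k ! * (η * M) := by
      simp [Fintype.card_perm]
    rw [h2] at h1
    have h3 := mul_le_mul_of_nonneg_left h1 hc0.le
    have h4 := (abs_le.1 hBw).1
    have h5 : c * (k ! * (η * M)) ≤ η * M := by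
      rw [← mul_assoc]
      exact mul_le_of_le_one_left (by positivity) (by linarith)
    -- The total is at least `c * M - 2 * η * M`, with one `η * M` from rounding and one from the
    -- other permutations, and `η ≤ c / 4`.
    have h6 := mul_le_mul_of_nonneg_right hη1 hM0
    rw [mul_sub] at h3
    linarith

-- Cylinders and `Disc` in the ultraproduct

universe u

section

variable {V : ℕ → Type u} {𝒰 : Ultrafilter ℕ} {k : ℕ}

lemma limSet_cylinder (𝒥 : Finset (Finset (Fin k))) (C : ∀ n, ∀ J : Finset (Fin k), Set (J → V n)) :
    limSet 𝒰 (fun n => cylinder 𝒥 (C n)) = cylinder 𝒥 fun J => limSet 𝒰 fun n => C n J := by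
  ext x
  obtain ⟨y, rfl⟩ := mkTuple_surjective x
  rw [mkTuple_mem_limSet]
  simp only [cylinder, Set.mem_ofPred_eq]
  rw [Filter.eventually_all_finset]
  exact forall₂_congr fun J _ => (mkTuple_mem_limSet (fun n => C n J) (fun n (j : J) => y n j)).symm

/-- The internal cylinder sets of a collection. -/
def internalCylinders (V : ℕ → Type u) (𝒰 : Ultrafilter ℕ) (𝒥 : Finset (Finset (Fin k))) :
    Set (Set (Fin k → UProd V 𝒰)) :=
  Set.range fun C : ∀ n, ∀ J : Finset (Fin k), Set (J → V n) =>
    limSet 𝒰 fun n => cylinder 𝒥 (C n)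

lemma univ_mem_internalCylinders (𝒥 : Finset (Finset (Fin k))) :
    Set.univ ∈ internalCylinders V 𝒰 𝒥 := by
  refine ⟨fun _ _ => Set.univ, Set.eq_univ_of_forall fun x => ?_⟩
  obtain ⟨y, rfl⟩ := mkTuple_surjective x
  simp [mkTuple_mem_limSet, cylinder]

lemma isPiSystem_internalCylinders (𝒥 : Finset (Finset (Fin k))) :
    IsPiSystem (internalCylinders V 𝒰 𝒥) := by
  rintro _ ⟨C, rfl⟩ _ ⟨D, rfl⟩ -
  refine ⟨fun n J => C n J ∩ D n J, ?_⟩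
  simp only
  rw [limSet_inter]
  congr 1
  ext n x
  simp only [cylinder, Set.mem_ofPred_eq, Set.mem_inter_iff, forall_and]

/-- Measurability of restriction to `J` need only be checked on internal sets, and the preimage of
one is an internal cylinder whose other sides are full. Unlike the defining generators, these are
limits of finite cylinders. -/
lemma subAlgebra_eq_generateFrom (𝒥 : Finset (Finset (Fin k))) :
    subAlgebra V 𝒰 𝒥 = MeasurableSpace.generateFrom (internalCylinders V 𝒰 𝒥) := by
  classical
  refine le_antisymm (MeasurableSpace.generateFrom_le ?_) (MeasurableSpace.generateFrom_le ?_)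
  · rintro S ⟨C, hC, rfl⟩
    have hr : ∀ J ∈ 𝒥, Measurable[MeasurableSpace.generateFrom (internalCylinders V 𝒰 𝒥)]
        (fun (x : Fin k → UProd V 𝒰) (j : J) => x j) := by
      intro J hJ
      refine @measurable_generateFrom _ _
        (MeasurableSpace.generateFrom (internalCylinders V 𝒰 𝒥)) _ _ ?_
      rintro S ⟨A, rfl⟩
      refine MeasurableSpace.measurableSet_generateFrom
        ⟨fun n => Function.update (fun _ => Set.univ) J (A n), ?_⟩
      simp only
      rw [limSet_cylinder]
      ext x
      simp only [cylinder, Set.mem_ofPred_eq, Set.mem_preimage]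
      constructor
      · intro h
        simpa using h J hJ
      · intro h I _
        rcases eq_or_ne I J with rfl | hne
        · simpa using h
        · obtain ⟨y, hy⟩ := mkTuple_surjective (fun i : I => x i)
          simp only [Function.update_of_ne hne]
          exact ⟨y, hy, by simp⟩
    simp only [Set.ofPred_forall]
    exact MeasurableSet.iInter fun J => MeasurableSet.iInter fun hJ => hr J hJ (hC J hJ)
  · rintro _ ⟨C, rfl⟩
    exact MeasurableSpace.measurableSet_generateFrom
      ⟨fun J => limSet 𝒰 fun n => C n J, fun J _ => measurableSet_limSet _, limSet_cylinder 𝒥 C⟩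

variable [∀ n, Finite (V n)] [∀ n, Nonempty (V n)]

lemma tendsto_density (h𝒰 : (𝒰 : Filter ℕ) ≤ cofinite) (A : ∀ n, Set (Fin k → V n)) :
    Tendsto (fun n => ((A n).ncard : ℝ) / (Nat.card (V n) : ℝ) ^ k) (𝒰 : Filter ℕ)
      (nhds ((loeb V 𝒰 (Fin k)).real (limSet 𝒰 A))) := by
  have := isProbabilityMeasure_loeb (V := V) (ι := Fin k) h𝒰
  have hne : ulimDensity 𝒰 A ≠ ∞ := by
    rw [← loeb_limSet h𝒰]
    exact measure_ne_top _ _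
  rw [measureReal_def, loeb_limSet h𝒰]
  refine ((ENNReal.tendsto_toReal hne).comp (tendsto_ulimDensity (𝒰 := 𝒰) A)).congr fun n => ?_
  simp

/-- `Disc_p` can be tested on the internal cylinder sets. -/
lemma disc_iff (h𝒰 : (𝒰 : Filter ℕ) ≤ cofinite) {p : ℝ} (hp : 0 ≤ p)
    (𝒥 : Finset (Finset (Fin k))) {E : Set (Fin k → UProd V 𝒰)} (hE : MeasurableSet E) :
    Disc p 𝒥 E ↔ ∀ S ∈ internalCylinders V 𝒰 𝒥,
      (loeb V 𝒰 (Fin k)).real (E ∩ S) = p * (loeb V 𝒰 (Fin k)).real S := by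
  have := isProbabilityMeasure_loeb (V := V) (ι := Fin k) h𝒰
  set μ := loeb V 𝒰 (Fin k)
  have hm := subAlgebra_le (V := V) (𝒰 := 𝒰) 𝒥
  have hint : Integrable (E.indicator fun _ => (1 : ℝ)) μ :=
    (integrable_const (1 : ℝ)).indicator hE
  have hset : ∀ S, MeasurableSet S → ∫ x in S, E.indicator (fun _ => (1 : ℝ)) x ∂μ =
      μ.real (E ∩ S) := by
    intro S _
    rw [integral_indicator hE, setIntegral_const, measureReal_restrict_apply hE]
    simp
  constructor
  · intro h S hS
    have hS' : MeasurableSet[subAlgebra V 𝒰 𝒥] S := by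
      rw [subAlgebra_eq_generateFrom]
      exact MeasurableSpace.measurableSet_generateFrom hS
    rw [← hset S (hm S hS'), ← setIntegral_condExp hm hint hS',
      setIntegral_congr_ae (g := fun _ => p) (hm S hS')
        (h.mono fun x hx _ => hx), setIntegral_const, smul_eq_mul, mul_comm]
  · intro h
    have hgen : ∀ S ∈ internalCylinders V 𝒰 𝒥,
        (μ.restrict E).trim hm S = (ENNReal.ofReal p • μ).trim hm S := by
      intro S hS
      have hS' : MeasurableSet[subAlgebra V 𝒰 𝒥] S := by
        rw [subAlgebra_eq_generateFrom]
        exact MeasurableSpace.measurableSet_generateFrom hS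
      rw [trim_measurableSet_eq hm hS', trim_measurableSet_eq hm hS',
        Measure.restrict_apply (hm S hS'), Set.inter_comm, Measure.smul_apply, smul_eq_mul,
        ← ofReal_measureReal, h S hS, ENNReal.ofReal_mul hp, ofReal_measureReal]
    -- Two finite measures that agree on a π-system containing the whole space agree on the
    -- σ-algebra it generates.
    have htrim : (μ.restrict E).trim hm = (ENNReal.ofReal p • μ).trim hm := by
      exact ext_of_generate_finite _ (subAlgebra_eq_generateFrom 𝒥)
        (isPiSystem_internalCylinders 𝒥) hgen (hgen _ (univ_mem_internalCylinders 𝒥))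
    have hreal : ∀ S, MeasurableSet[subAlgebra V 𝒰 𝒥] S → μ.real (E ∩ S) = p * μ.real S := by
      intro S hS
      have := congrArg (fun ν => ν S) htrim
      simp only [trim_measurableSet_eq hm hS] at this
      rw [Measure.restrict_apply (hm S hS), Set.inter_comm, Measure.smul_apply, smul_eq_mul] at this
      rw [measureReal_def, this, ENNReal.toReal_mul, ENNReal.toReal_ofReal hp, measureReal_def]
    refine (ae_eq_condExp_of_forall_setIntegral_eq hm hint
      (fun S _ _ => integrableOn_const (measure_ne_top _ _))
      (fun S hS _ => ?_) aestronglyMeasurable_const).symm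
    rw [hset S (hm S hS), hreal S hS, setIntegral_const]
    simp [mul_comm]

end

/-! ### Construction of the separating set -/

/-- This makes the measure of `E` a special case of the correlation bound: the whole space is a
cylinder of `{∅}`. -/
lemma not_collLE_singleton_empty {k : ℕ} {ℐ : Finset (Finset (Fin k))} (hℐ : SubsetFree ℐ)
    (hℐ' : ℐ ≠ {∅}) : ¬ CollLE ℐ {∅} := by
  rintro ⟨π, hπ⟩
  obtain ⟨I, hI⟩ := hℐ.1
  obtain ⟨J, hJ, hIJ⟩ := hπ I hI
  rw [Finset.mem_singleton.1 hJ, Finset.image_empty, Finset.subset_empty] at hIJ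
  exact (hℐ.nonempty_of_mem hℐ' hI).ne_empty hIJ

/-- A diagonal choice: if `f` tends to infinity, then `N (m n) ≤ f n` eventually, for some `m` that
tends to infinity. -/
lemma exists_tendsto_atTop_of_tendsto {f N : ℕ → ℕ} (hf : Tendsto f atTop atTop) :
    ∃ m : ℕ → ℕ, Tendsto m atTop atTop ∧ ∀ᶠ n in atTop, N (m n) ≤ f n := by
  refine ⟨fun n => Nat.findGreatest (fun m => N m ≤ f n) n, tendsto_atTop.2 fun M => ?_, ?_⟩
  · filter_upwards [hf.eventually_ge_atTop (N M), eventually_ge_atTop M] with n h1 h2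
    exact Nat.le_findGreatest h2 h1
  · filter_upwards [hf.eventually_ge_atTop (N 0)] with n h
    exact Nat.findGreatest_spec (P := fun m => N m ≤ f n) (Nat.zero_le n) h

/-- For every collection `ℐ` there is a symmetric set that is not `Disc_p[ℐ]` but is `Disc_p[𝒥]` for all
`𝒥` not above `ℐ`. -/
theorem exists_separating_set
    (V : ℕ → Type*) [∀ n, Finite (V n)] [∀ n, Nonempty (V n)]
    (hV : Filter.Tendsto (fun n => Nat.card (V n)) Filter.atTop Filter.atTop)
    (𝒰 : Ultrafilter ℕ) (h𝒰 : (𝒰 : Filter ℕ) ≤ Filter.cofinite)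
    (k : ℕ) (ℐ : Finset (Finset (Fin k))) (hℐ : SubsetFree ℐ) (hℐ' : ℐ ≠ {∅})
    (p : ℝ) (hp0 : 0 < p) (hp1 : p < 1) :
    ∃ E : Set (Fin k → UProd V 𝒰),
      MeasurableSet E ∧ Symmetric E ∧
      loeb V 𝒰 (Fin k) E = ENNReal.ofReal p ∧
      ¬ Disc p ℐ E ∧
      ∀ 𝒥 : Finset (Finset (Fin k)), SubsetFree 𝒥 → ¬ CollLE ℐ 𝒥 →
        Disc p 𝒥 E := by
  classical
  have hprob := isProbabilityMeasure_loeb (V := V) (ι := Fin k) h𝒰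
  have h𝒰' : (𝒰 : Filter ℕ) ≤ atTop := Nat.cofinite_eq_atTop ▸ h𝒰
  obtain ⟨δ, hδ, hfin⟩ := exists_finite_separation hℐ hℐ' hp0 hp1
  -- The tolerance `1 / (m + 1)` must tend to zero along the sequence while `δ` stays fixed; the
  -- diagonal choice of `m n` achieves this.
  have hfin' := fun m : ℕ => hfin (1 / ((m : ℝ) + 1)) Nat.one_div_pos_of_nat
  choose N hN using hfin'
  obtain ⟨m, hm, hNm⟩ := exists_tendsto_atTop_of_tendsto (N := N) hV
  have hNm' : ∀ᶠ n in (𝒰 : Filter ℕ), N (m n) ≤ Nat.card (V n) := h𝒰' hNm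
  have hA := fun n (h : N (m n) ≤ Nat.card (V n)) => hN (m n) h
  choose! A hAσ hAdisc C hC using hA
  have hpos : ∀ n, (0 : ℝ) < (Nat.card (V n) : ℝ) ^ k := fun n => by
    have : 0 < Nat.card (V n) := Nat.card_pos
    positivity
  have hlim : ∀ 𝒥 (D : ∀ n, ∀ J : Finset (Fin k), Set (J → V n)),
      Tendsto (fun n => (((A n ∩ cylinder 𝒥 (D n)).ncard : ℝ) - p * (cylinder 𝒥 (D n)).ncard) /
        (Nat.card (V n) : ℝ) ^ k) (𝒰 : Filter ℕ)
        (nhds ((loeb V 𝒰 (Fin k)).real (limSet 𝒰 A ∩ limSet 𝒰 fun n => cylinder 𝒥 (D n)) -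
          p * (loeb V 𝒰 (Fin k)).real (limSet 𝒰 fun n => cylinder 𝒥 (D n)))) := by
    intro 𝒥 D
    rw [limSet_inter]
    refine ((tendsto_density h𝒰 _).sub ((tendsto_density h𝒰 _).const_mul p)).congr fun n => ?_
    ring
  have hdisc : ∀ 𝒥, ¬ CollLE ℐ 𝒥 → ∀ S ∈ internalCylinders V 𝒰 𝒥,
      (loeb V 𝒰 (Fin k)).real (limSet 𝒰 A ∩ S) = p * (loeb V 𝒰 (Fin k)).real S := by
    rintro 𝒥 h𝒥 _ ⟨D, rfl⟩
    refine sub_eq_zero.1 (tendsto_nhds_unique (hlim 𝒥 D) ?_)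
    refine squeeze_zero_norm' ?_
      (tendsto_one_div_add_atTop_nhds_zero_nat.comp (hm.mono_left h𝒰'))
    filter_upwards [hNm'] with n hn
    rw [norm_div, Real.norm_eq_abs, Real.norm_eq_abs, abs_of_pos (hpos n), div_le_iff₀ (hpos n)]
    exact hAdisc n hn 𝒥 h𝒥 (D n)
  refine ⟨limSet 𝒰 A, measurableSet_limSet A, fun σ x => ?_, ?_, fun hD => ?_, fun 𝒥 _ h𝒥 => ?_⟩
  · obtain ⟨y, rfl⟩ := mkTuple_surjective x
    change mkTuple 𝒰 (fun n => y n ∘ σ) ∈ limSet 𝒰 A ↔ _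
    rw [mkTuple_mem_limSet, mkTuple_mem_limSet]
    exact Filter.eventually_congr (hNm'.mono fun n hn => hAσ n hn σ (y n))
  · have := hdisc {∅} (not_collLE_singleton_empty hℐ hℐ') _ (univ_mem_internalCylinders _)
    rw [Set.inter_univ, MeasureTheory.probReal_univ, mul_one] at this
    rw [← this, MeasureTheory.ofReal_measureReal]
  · have h0 := (disc_iff h𝒰 hp0.le ℐ (measurableSet_limSet A)).1 hD _ ⟨C, rfl⟩
    -- The finite cylinders of correlation at least `δ` converge to one internal cylinder, on which
    -- the correlation is still at least `δ`.
    have hle := le_of_tendsto_of_tendsto tendsto_const_nhds (hlim ℐ C).abs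
      (hNm'.mono fun n hn => show δ ≤ _ by
        beta_reduce
        rw [abs_div, abs_of_pos (hpos n), le_div_iff₀ (hpos n)]
        exact hC n hn)
    rw [sub_eq_zero.2 h0, abs_zero] at hle
    exact absurd hle (not_le.2 hδ)
  · exact (disc_iff h𝒰 hp0.le 𝒥 (measurableSet_limSet A)).2 (hdisc 𝒥 h𝒥)

end Quasirandom

end

theorem mainTheorem6
    (V : ℕ → Type*) [∀ n, Finite (V n)] [∀ n, Nonempty (V n)]
    (hV : Filter.Tendsto (fun n => Nat.card (V n)) Filter.atTop Filter.atTop)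
    (𝒰 : Ultrafilter ℕ) (h𝒰 : (𝒰 : Filter ℕ) ≤ Filter.cofinite)
    (k : ℕ) (ℐ : Finset (Finset (Fin k))) (hℐ : Quasirandom.SubsetFree ℐ) (hℐ' : ℐ ≠ {∅})
    (p : ℝ) (hp0 : 0 < p) (hp1 : p < 1) :
    ∃ E : Set (Fin k → Quasirandom.UProd V 𝒰),
      MeasurableSet E ∧ Quasirandom.Symmetric E ∧
      Quasirandom.loeb V 𝒰 (Fin k) E = ENNReal.ofReal p ∧
      ¬ Quasirandom.Disc p ℐ E ∧
      ∀ 𝒥 : Finset (Finset (Fin k)), Quasirandom.SubsetFree 𝒥 → ¬ Quasirandom.CollLE ℐ 𝒥 →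
        Quasirandom.Disc p 𝒥 E := by
  exact Quasirandom.exists_separating_set V hV 𝒰 h𝒰 k ℐ hℐ hℐ' p hp0 hp1
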